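/- **Theorem (Local error bound).** Let $n,d\ge 1$ be integers, $\mu>0$ and $\alpha\ge 0$. Let $W\in\mathbb R^{n\times n}$ be a symmetric matrix (the weighted adjacency matrix of the measurement graph) with $W_{ii}=\mu$ for all $i\in[n]=\{1,\dots,n\}$, and put $A:=W\otimes(1_d1_d^\top)\in\mathbb R^{nd\times nd}$. Let $\mathcal O(d)=\{g\in\mathbb R^{d\times d}: g^\top g=I_d\}$, and let $\mathcal O(d)^{\otimes n}$ be the set of $G=[G_1;\dots;G_n]\in\mathbb R^{nd\times d}$ with all $d\times d$ blocks $G_i\in\mathcal O(d)$. Let $G^\star\in\mathcal O(d)^{\otimes n}$, let $\Delta\in\mathbb R^{nd\times nd}$ be symmetric with zero diagonal $d\times d$ blocks, let $$C:=A\circ(G^\star G^{\star\top}+\Delta),\qquad \tilde C:=C+\alpha I_{nd},$$ where $\circ$ is the entrywise product, and let $\hat G\in\mathcal O(d)^{\otimes n}$ be any global maximizer of $G\mapsto\operatorname{tr}(G^\top CG)$ over $\mathcal O(d)^{\otimes n}$. For $X\in\mathbb R^{nd\times nd}$ let $X_i\in\mathbb R^{nd\times d}$ be its $i$-th block column. Let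 $\|\cdot\|$ be the operator norm and $\|\cdot\|_F$ the Frobenius norm. For $X=[X_1;\dots;X_n]\in\mathbb R^{nd\times d}$ with $d\times d$ blocks $X_i$ let $\|X\|_\infty:=\max_{i\in[n]}\|X_i\|$. For $X,Y\in\mathbb R^{nd\times d}$ let ${\rm d}(X,Y):=\min_{g\in\mathcal O(d)}\|X-Yg\|_F$. For $G\in\mathcal O(d)^{\otimes n}$ let $$D_\alpha(G):={\rm Diag}\big([(\tilde C_1^\top GG^\top\tilde C_1)^{1/2};\dots;(\tilde C_n^\top GG^\top\tilde C_n)^{1/2}]\big)-\tilde C,\qquad \rho_\alpha(G):=\|D_\alpha(G)G\|_F ,$$ where ${\rm Diag}$ forms the block diagonal matrix with the given $d\times d$ blocks and $(\cdot)^{1/2}$ is the positive semidefinite square root. Suppose that (i) $\|W-\mu 1_n1_n^\top\|+\|A\circ\Delta\|\le \dfrac{n^{3/4}\mu}{40\,d^{1/2}}$ and $\|(A\circ\Delta)G^\star\|_\infty\le \dfrac{n\mu}{10}$; (ii) $\max_{i\in[n]}\Big\|\big((A-\mu 1_{nd}1_{nd}^\top)\circ G^\star G^{\star\top}\big)_i^\top\hat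 G\Big\|\le \dfrac{n\mu}{10}$; (iii) $\alpha\le \dfrac{n\mu}{20\sqrt2}$. Then every $G\in\mathcal O(d)^{\otimes n}$ with ${\rm d}(G,G^\star)\le \sqrt n/5$ satisfies $$\frac{n\mu}{10}\,{\rm d}(G,\hat G)\le\rho_\alpha(G).$$ -/

import Mathlib

open scoped Matrix Kronecker

namespace OrthSync

/-- The `i`-th `d × d` block `X_i` of `X ∈ ℝ^{nd×d}`. Rows are indexed by pairs
(block number, position inside the block). -/
def block {n d : ℕ} (X : Matrix (Fin n × Fin d) (Fin d) ℝ) (i : Fin n) :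
    Matrix (Fin d) (Fin d) ℝ :=
  X.submatrix (fun a => (i, a)) id

/-- The `i`-th block column `X_i ∈ ℝ^{nd×d}` of `X ∈ ℝ^{nd×nd}`. -/
def blockCol {n d : ℕ} (X : Matrix (Fin n × Fin d) (Fin n × Fin d) ℝ) (i : Fin n) :
    Matrix (Fin n × Fin d) (Fin d) ℝ :=
  X.submatrix id (fun b => (i, b))

/-- The `ij`-th `d × d` block `X_{ij}` of `X ∈ ℝ^{nd×nd}`. -/
def blockEntry {n d : ℕ} (X : Matrix (Fin n × Fin d) (Fin n × Fin d) ℝ) (i j : Fin n) :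
    Matrix (Fin d) (Fin d) ℝ :=
  X.submatrix (fun a => (i, a)) (fun b => (j, b))

/-- The block diagonal matrix in `ℝ^{nd×nd}` with diagonal blocks `B_1, …, B_n`. -/
def blockDiag {n d : ℕ} (B : Fin n → Matrix (Fin d) (Fin d) ℝ) :
    Matrix (Fin n × Fin d) (Fin n × Fin d) ℝ :=
  Matrix.of fun p q => if p.1 = q.1 then B p.1 p.2 q.2 else 0

open scoped Matrix.Norms.L2Operator in
/-- The operator norm, with respect to the Euclidean norms. -/
noncomputable def opNorm {m k : Type*} [Fintype m] [Fintype k] [DecidableEq k]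
    (X : Matrix m k ℝ) : ℝ := ‖X‖

open scoped Matrix.Norms.Frobenius in
/-- The Frobenius norm. -/
noncomputable def frobNorm {m k : Type*} [Fintype m] [Fintype k] (X : Matrix m k ℝ) : ℝ := ‖X‖

/-- `‖X‖_∞ = max_i ‖X_i‖` for `X ∈ ℝ^{nd×d}`, the maximum of the operator norms of the blocks. -/
noncomputable def blockSupNorm {n d : ℕ} (X : Matrix (Fin n × Fin d) (Fin d) ℝ) : ℝ :=
  ⨆ i : Fin n, opNorm (block X i)

/-- `O(d)^{⊗n}`: the matrices in `ℝ^{nd×d}` all of whose `d × d` blocks are orthogonal. -/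
def orthBlocks (n d : ℕ) : Set (Matrix (Fin n × Fin d) (Fin d) ℝ) :=
  {G | ∀ i, block G i ∈ Matrix.orthogonalGroup (Fin d) ℝ}

/-- `d(X, Y) = min_{g ∈ O(d)} ‖X - Y g‖_F`. The infimum is attained, since `O(d)` is compact. -/
noncomputable def orthDist {n d : ℕ} (X Y : Matrix (Fin n × Fin d) (Fin d) ℝ) : ℝ :=
  ⨅ g : Matrix.orthogonalGroup (Fin d) ℝ,
    frobNorm (X - Y * (g : Matrix (Fin d) (Fin d) ℝ))

/-- `A = W ⊗ (1_d 1_dᵀ)`. -/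
def weightMat {n : ℕ} (d : ℕ) (W : Matrix (Fin n) (Fin n) ℝ) :
    Matrix (Fin n × Fin d) (Fin n × Fin d) ℝ :=
  W ⊗ₖ (Matrix.of fun _ _ => (1 : ℝ))

/-- `c · 1 1ᵀ`, the matrix all of whose entries are `c`. -/
def constMat (m : Type*) (c : ℝ) : Matrix m m ℝ := Matrix.of fun _ _ => c

/-- The measurement matrix `C = A ∘ (G⋆ G⋆ᵀ + Δ)` of the additive noise model. -/
def measMat {n d : ℕ} (W : Matrix (Fin n) (Fin n) ℝ)
    (Gstar : Matrix (Fin n × Fin d) (Fin d) ℝ)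
    (Δ : Matrix (Fin n × Fin d) (Fin n × Fin d) ℝ) :
    Matrix (Fin n × Fin d) (Fin n × Fin d) ℝ :=
  weightMat d W ⊙ (Gstar * Gstarᵀ + Δ)

/-- `Ghat` is a global maximizer of `f(G) = tr(Gᵀ C G)` over `O(d)^{⊗n}`. -/
def IsGlobalMaximizer {n d : ℕ} (C : Matrix (Fin n × Fin d) (Fin n × Fin d) ℝ)
    (Ghat : Matrix (Fin n × Fin d) (Fin d) ℝ) : Prop :=
  Ghat ∈ orthBlocks n d ∧ ∀ G ∈ orthBlocks n d, (Gᵀ * C * G).trace ≤ (Ghatᵀ * C * Ghat).trace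

/-- `C̃ = C + α I_{nd}`. -/
def shifted {n d : ℕ} (α : ℝ) (C : Matrix (Fin n × Fin d) (Fin n × Fin d) ℝ) :
    Matrix (Fin n × Fin d) (Fin n × Fin d) ℝ :=
  C + α • (1 : Matrix (Fin n × Fin d) (Fin n × Fin d) ℝ)

open scoped MatrixOrder in
/-- `(X Xᵀ)^{1/2}`, the positive semidefinite square root of `X Xᵀ`. -/
noncomputable def leftAbs {d : ℕ} (X : Matrix (Fin d) (Fin d) ℝ) : Matrix (Fin d) (Fin d) ℝ :=
  CFC.sqrt (X * Xᵀ)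

open scoped MatrixOrder in
/-- For every singular value decomposition `X = U Diag(σ) Vᵀ` one has
`(X Xᵀ)^{1/2} = U Diag(σ) Uᵀ`. -/
theorem leftAbs_eq_of_svd {d : ℕ} {X U V : Matrix (Fin d) (Fin d) ℝ} {σ : Fin d → ℝ}
    (hU : U ∈ Matrix.orthogonalGroup (Fin d) ℝ) (hV : V ∈ Matrix.orthogonalGroup (Fin d) ℝ)
    (hσ : ∀ l, 0 ≤ σ l) (hX : X = U * Matrix.diagonal σ * Vᵀ) :
    leftAbs X = U * Matrix.diagonal σ * Uᵀ := by
  have hU' : Uᵀ * U = 1 := (Matrix.mem_orthogonalGroup_iff' (Fin d) ℝ).1 hU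
  have hV' : Vᵀ * V = 1 := (Matrix.mem_orthogonalGroup_iff' (Fin d) ℝ).1 hV
  refine CFC.sqrt_unique ?_ ?_
  · have h1 : U * Matrix.diagonal σ * Uᵀ * (U * Matrix.diagonal σ * Uᵀ)
        = U * Matrix.diagonal σ * (Uᵀ * U) * Matrix.diagonal σ * Uᵀ := by
      simp only [Matrix.mul_assoc]
    have h2 : X * Xᵀ = U * Matrix.diagonal σ * (Vᵀ * V) * Matrix.diagonal σ * Uᵀ := by
      rw [hX]
      simp only [Matrix.transpose_mul, Matrix.transpose_transpose, Matrix.diagonal_transpose,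
        Matrix.mul_assoc]
    rw [h1, h2, hU', hV']
  · refine Matrix.PosSemidef.nonneg ?_
    have h := (Matrix.PosSemidef.diagonal hσ).mul_mul_conjTranspose_same U
    simpa [Matrix.conjTranspose_eq_transpose_of_trivial] using h

/-- `D_α(G)`: the block diagonal matrix with blocks `(C̃_iᵀ G Gᵀ C̃_i)^{1/2}`, minus `C̃`. -/
noncomputable def residualMat {n d : ℕ} (α : ℝ)
    (C : Matrix (Fin n × Fin d) (Fin n × Fin d) ℝ) (G : Matrix (Fin n × Fin d) (Fin d) ℝ) :
    Matrix (Fin n × Fin d) (Fin n × Fin d) ℝ :=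
  blockDiag (fun i => leftAbs ((blockCol (shifted α C) i)ᵀ * G)) - shifted α C

/-- The residual function `ρ_α(G) = ‖D_α(G) G‖_F`. -/
noncomputable def residual {n d : ℕ} (α : ℝ)
    (C : Matrix (Fin n × Fin d) (Fin n × Fin d) ℝ) (G : Matrix (Fin n × Fin d) (Fin d) ℝ) : ℝ :=
  frobNorm (residualMat α C G * G)

end OrthSync

/-! Choose an orthogonal g such that Y = Ĝg is optimally aligned with G, and put V = G - Y, so that
‖V‖_F = d(G, Ĝ) and GᵀY is positive semidefinite. By Cauchy–Schwarz it suffices to show tr(Vᵀ D_α(G)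
G) ≥ (nμ/10)‖V‖² (`le_mul_residual`).

Write D_α(G)G = BG - CV - CY - αG with B the block diagonal of square roots. The BG term contributes
a nonnegative amount merely because the blocks of B are positive semidefinite. The αG term costs
exactly α/2 · ‖V‖². The gain comes from CY: optimality of Y makes each S_i = (CY)_i Y_iᵀ positive
semidefinite, and the hypotheses improve this to S_i ⪰ s I with s of order nμ, which yields s/2 ·
‖V‖².

The loss from CV is controlled by C = μXXᵀ + N, where X is G⋆ aligned with Y and N collects weight
deviation and noise. The rank-d part sees only XᵀV, which alignment makes small, and N has norm at
most ν.

Everything rests on δ = ‖X - Y‖_F ≤ n^{1/4}/10, obtained by comparing objective values at X and Y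
(`mul_frobNorm_sub_le`). `local_error_constants` then balances the terms. -/

namespace OrthSync

open Matrix

/-! ### Frobenius and operator norm inequalities -/

section Frobenius

variable {m k l : Type*} [Fintype m] [Fintype k] [Fintype l]

open scoped Matrix.Norms.Frobenius in
theorem frobNorm_nonneg (X : Matrix m k ℝ) : 0 ≤ frobNorm X := norm_nonneg X

open scoped Matrix.Norms.Frobenius in
theorem frobNorm_add_le (X Y : Matrix m k ℝ) : frobNorm (X + Y) ≤ frobNorm X + frobNorm Y :=
  norm_add_le X Y

open scoped Matrix.Norms.Frobenius in
theorem frobNorm_sub_rev (X Y : Matrix m k ℝ) : frobNorm (X - Y) = frobNorm (Y - X) :=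
  norm_sub_rev X Y

open scoped Matrix.Norms.Frobenius in
theorem frobNorm_smul (c : ℝ) (X : Matrix m k ℝ) : frobNorm (c • X) = |c| * frobNorm X :=
  norm_smul c X

open scoped Matrix.Norms.Frobenius in
theorem frobNorm_mul_le_mul (X : Matrix m k ℝ) (Y : Matrix k l ℝ) :
    frobNorm (X * Y) ≤ frobNorm X * frobNorm Y :=
  frobenius_norm_mul X Y

open scoped Matrix.Norms.Frobenius in
theorem frobNorm_sq_eq_sum (X : Matrix m k ℝ) : frobNorm X ^ 2 = ∑ i, ∑ j, X i j ^ 2 := by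
  have h : 0 ≤ ∑ i, ∑ j, X i j ^ 2 :=
    Finset.sum_nonneg fun i _ => Finset.sum_nonneg fun j _ => sq_nonneg _
  have : frobNorm X = Real.sqrt (∑ i, ∑ j, X i j ^ 2) := by
    rw [frobNorm, frobenius_norm_def, Real.sqrt_eq_rpow]
    simp
  rw [this, Real.sq_sqrt h]

theorem trace_transpose_mul_eq_sum (X Y : Matrix m k ℝ) :
    (Xᵀ * Y).trace = ∑ i, ∑ j, X i j * Y i j := by
  rw [Finset.sum_comm]
  simp [trace, mul_apply]

theorem frobNorm_sq (X : Matrix m k ℝ) : frobNorm X ^ 2 = (Xᵀ * X).trace := by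
  rw [frobNorm_sq_eq_sum, trace_transpose_mul_eq_sum]
  simp only [sq]

theorem trace_transpose_mul_comm (X Y : Matrix m k ℝ) : (Xᵀ * Y).trace = (Yᵀ * X).trace := by
  rw [← trace_transpose, transpose_mul, transpose_transpose]

theorem trace_transpose_mul_le (X Y : Matrix m k ℝ) :
    (Xᵀ * Y).trace ≤ frobNorm X * frobNorm Y := by
  refine (abs_le_of_sq_le_sq' ?_ (mul_nonneg (frobNorm_nonneg X) (frobNorm_nonneg Y))).2
  rw [mul_pow, frobNorm_sq_eq_sum, frobNorm_sq_eq_sum, trace_transpose_mul_eq_sum,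
    ← Fintype.sum_prod_type', ← Fintype.sum_prod_type', ← Fintype.sum_prod_type']
  exact Finset.sum_mul_sq_le_sq_mul_sq _ _ _

theorem frobNorm_neg (X : Matrix m k ℝ) : frobNorm (-X) = frobNorm X := by
  simpa using frobNorm_smul (-1) X

open scoped Matrix.Norms.Frobenius in
theorem frobNorm_transpose (X : Matrix m k ℝ) : frobNorm Xᵀ = frobNorm X :=
  frobenius_norm_transpose X

theorem neg_mul_le_trace_transpose_mul (X Y : Matrix m k ℝ) :
    -(frobNorm X * frobNorm Y) ≤ (Xᵀ * Y).trace := by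
  have h := trace_transpose_mul_le X (-Y)
  rw [frobNorm_neg, Matrix.mul_neg, trace_neg] at h
  linarith

theorem frobNorm_mul_of_mul_transpose [DecidableEq k] (X : Matrix m k ℝ) {g : Matrix k k ℝ}
    (hg : g * gᵀ = 1) : frobNorm (X * g) = frobNorm X := by
  rw [← sq_eq_sq₀ (frobNorm_nonneg _) (frobNorm_nonneg _), frobNorm_sq, frobNorm_sq,
    transpose_mul, Matrix.mul_assoc, trace_mul_comm, Matrix.mul_assoc, Matrix.mul_assoc, hg,
    Matrix.mul_one]

theorem frobNorm_mul_of_transpose_mul [DecidableEq m] (X : Matrix m k ℝ) {g : Matrix l m ℝ}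
    (hg : gᵀ * g = 1) : frobNorm (g * X) = frobNorm X := by
  rw [← sq_eq_sq₀ (frobNorm_nonneg _) (frobNorm_nonneg _), frobNorm_sq, frobNorm_sq,
    transpose_mul, Matrix.mul_assoc, ← Matrix.mul_assoc gᵀ, hg, Matrix.one_mul]

theorem norm_toLp_sq (x : k → ℝ) : ‖WithLp.toLp 2 x‖ ^ 2 = x ⬝ᵥ x := by
  rw [EuclideanSpace.norm_sq_eq]
  simp [dotProduct, sq]

open scoped Matrix.Norms.L2Operator in
theorem opNorm_nonneg [DecidableEq k] (X : Matrix m k ℝ) : 0 ≤ opNorm X := norm_nonneg X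

open scoped Matrix.Norms.L2Operator in
theorem norm_mulVec_le_opNorm [DecidableEq k] (X : Matrix m k ℝ) (x : k → ℝ) :
    ‖WithLp.toLp 2 (X *ᵥ x)‖ ≤ opNorm X * ‖WithLp.toLp 2 x‖ :=
  l2_opNorm_mulVec X (WithLp.toLp 2 x)

open scoped Matrix.Norms.Frobenius in
theorem norm_mulVec_le_frobNorm (X : Matrix m k ℝ) (x : k → ℝ) :
    ‖WithLp.toLp 2 (X *ᵥ x)‖ ≤ frobNorm X * ‖WithLp.toLp 2 x‖ := by
  have h := frobNorm_mul_le_mul X (replicateCol Unit x)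
  rw [← replicateCol_mulVec] at h
  simpa only [frobNorm, frobenius_norm_replicateCol] using h

theorem frobNorm_sq_eq_sum_col (X : Matrix m k ℝ) :
    frobNorm X ^ 2 = ∑ j, ‖WithLp.toLp 2 (X.col j)‖ ^ 2 := by
  rw [frobNorm_sq_eq_sum, Finset.sum_comm]
  simp only [norm_toLp_sq, dotProduct]
  simp only [sq, col_apply]

theorem frobNorm_mul_le [DecidableEq k] (X : Matrix m k ℝ) (Y : Matrix k l ℝ) :
    frobNorm (X * Y) ≤ opNorm X * frobNorm Y := by
  refine (abs_le_of_sq_le_sq' ?_ (mul_nonneg (opNorm_nonneg X) (frobNorm_nonneg Y))).2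
  rw [mul_pow, frobNorm_sq_eq_sum_col, frobNorm_sq_eq_sum_col, Finset.mul_sum]
  refine Finset.sum_le_sum fun j _ => ?_
  rw [← mul_pow]
  exact pow_le_pow_left₀ (norm_nonneg _) (norm_mulVec_le_opNorm X (Y.col j)) 2

theorem norm_toLp_mulVec_of_transpose_mul [DecidableEq k] {g : Matrix m k ℝ} (hg : gᵀ * g = 1)
    (x : k → ℝ) : ‖WithLp.toLp 2 (g *ᵥ x)‖ = ‖WithLp.toLp 2 x‖ := by
  rw [← sq_eq_sq₀ (norm_nonneg _) (norm_nonneg _), norm_toLp_sq, norm_toLp_sq,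
    dotProduct_mulVec, vecMul_mulVec, ← dotProduct_mulVec, hg, one_mulVec]

end Frobenius

/-! ### Blockwise traces and norms -/

section Blocks

variable {n d : ℕ}

theorem trace_transpose_mul_eq_sum_block (X Y : Matrix (Fin n × Fin d) (Fin d) ℝ) :
    (Xᵀ * Y).trace = ∑ i, ((block X i)ᵀ * block Y i).trace := by
  simp only [trace_transpose_mul_eq_sum, Fintype.sum_prod_type, block, submatrix_apply, id]

theorem frobNorm_sq_eq_sum_block (X : Matrix (Fin n × Fin d) (Fin d) ℝ) :
    frobNorm X ^ 2 = ∑ i, frobNorm (block X i) ^ 2 := by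
  simp only [frobNorm_sq, trace_transpose_mul_eq_sum_block]

theorem block_transpose_mul_block {X : Matrix (Fin n × Fin d) (Fin d) ℝ}
    (hX : X ∈ orthBlocks n d) (i : Fin n) : (block X i)ᵀ * block X i = 1 :=
  (mem_orthogonalGroup_iff' (Fin d) ℝ).1 (hX i)

theorem block_mul_block_transpose {X : Matrix (Fin n × Fin d) (Fin d) ℝ}
    (hX : X ∈ orthBlocks n d) (i : Fin n) : block X i * (block X i)ᵀ = 1 :=
  (mem_orthogonalGroup_iff (Fin d) ℝ).1 (hX i)

theorem transpose_mul_eq_sum_block (X Y : Matrix (Fin n × Fin d) (Fin d) ℝ) :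
    Xᵀ * Y = ∑ i, (block X i)ᵀ * block Y i := by
  ext a b
  simp [mul_apply, Fintype.sum_prod_type, block, Matrix.sum_apply]

theorem transpose_mul_self_of_mem_orthBlocks {X : Matrix (Fin n × Fin d) (Fin d) ℝ}
    (hX : X ∈ orthBlocks n d) : Xᵀ * X = (n : ℝ) • 1 := by
  rw [transpose_mul_eq_sum_block]
  simp [block_transpose_mul_block hX, Nat.cast_smul_eq_nsmul]

theorem mul_mem_orthBlocks {X : Matrix (Fin n × Fin d) (Fin d) ℝ} (hX : X ∈ orthBlocks n d)
    {g : Matrix (Fin d) (Fin d) ℝ} (hg : g ∈ orthogonalGroup (Fin d) ℝ) :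
    X * g ∈ orthBlocks n d :=
  fun i => mul_mem (hX i) hg

end Blocks

/-! ### Maximizing a linear functional over the orthogonal group -/

section Optimality

theorem trace_vecMulVec_mul {k : Type*} [Fintype k] (Y : Matrix k k ℝ) (u v : k → ℝ) :
    (vecMulVec u v * Y).trace = v ⬝ᵥ Y *ᵥ u := by
  rw [trace_mul_comm, mul_vecMulVec, trace_vecMulVec, dotProduct_comm]

variable {k : Type*} [Fintype k] [DecidableEq k]

/-- The reflection in the hyperplane orthogonal to `v`. -/
noncomputable def reflection (v : k → ℝ) : Matrix k k ℝ := 1 - (2 / (v ⬝ᵥ v)) • vecMulVec v v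

theorem reflection_mem_orthogonalGroup {v : k → ℝ} (hv : v ⬝ᵥ v ≠ 0) :
    reflection v ∈ orthogonalGroup k ℝ := by
  have ht : (reflection v)ᵀ = reflection v := by
    simp [reflection, transpose_sub, transpose_smul, transpose_vecMulVec]
  rw [mem_orthogonalGroup_iff]
  change reflection v * (reflection v)ᵀ = 1
  rw [ht]
  simp only [reflection, Matrix.sub_mul, Matrix.mul_sub, Matrix.one_mul, Matrix.mul_one,
    Matrix.smul_mul, Matrix.mul_smul, vecMulVec_mul_vecMulVec, vecMulVec_smul,
    smul_smul]
  rw [div_mul_cancel₀ _ hv, two_smul, sub_add_cancel_left, smul_neg, sub_neg_eq_add,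
    sub_add_cancel]

/-- Replacing the identity by the reflection in v⊥ changes the trace by -2 vᵀYv / vᵀv, so this form
cannot be negative. -/
theorem dotProduct_mulVec_nonneg_of_trace_le {Y : Matrix k k ℝ}
    (hY : ∀ U ∈ orthogonalGroup k ℝ, (U * Y).trace ≤ Y.trace) (v : k → ℝ) : 0 ≤ v ⬝ᵥ Y *ᵥ v := by
  rcases eq_or_ne v 0 with rfl | hv
  · simp
  have hpos : 0 < v ⬝ᵥ v := by
    rw [← norm_toLp_sq]
    exact pow_pos (norm_pos_iff.2 (by simpa using hv)) 2
  have h := hY _ (reflection_mem_orthogonalGroup hpos.ne')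
  rw [reflection, Matrix.sub_mul, Matrix.one_mul, Matrix.smul_mul, trace_sub, trace_smul,
    trace_vecMulVec_mul, smul_eq_mul] at h
  have : 0 ≤ 2 / (v ⬝ᵥ v) * (v ⬝ᵥ Y *ᵥ v) := by linarith
  exact nonneg_of_mul_nonneg_right this (by positivity)

/-- The competitor is a product of two reflections, a rotation in the plane of u and v; denominators
are cleared. -/
theorem two_mul_dotProduct_mul_le_of_trace_le {Y : Matrix k k ℝ}
    (hY : ∀ U ∈ orthogonalGroup k ℝ, (U * Y).trace ≤ Y.trace)
    {u v : k → ℝ} (hu : 0 < u ⬝ᵥ u)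
    (hv : 0 < v ⬝ᵥ v) :
    2 * (u ⬝ᵥ v) * (v ⬝ᵥ Y *ᵥ u) ≤ (v ⬝ᵥ v) * (u ⬝ᵥ Y *ᵥ u) + (u ⬝ᵥ u) * (v ⬝ᵥ Y *ᵥ v) := by
  have h := hY _ (mul_mem (reflection_mem_orthogonalGroup hu.ne')
    (reflection_mem_orthogonalGroup hv.ne'))
  simp only [reflection, Matrix.sub_mul, Matrix.mul_sub, Matrix.one_mul, Matrix.mul_one,
    Matrix.smul_mul, Matrix.mul_smul, vecMulVec_mul_vecMulVec, vecMulVec_smul,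
    trace_sub, trace_smul, trace_vecMulVec_mul, smul_eq_mul] at h
  have h2 : 2 / (u ⬝ᵥ u) * (2 / (v ⬝ᵥ v) * ((u ⬝ᵥ v) * (v ⬝ᵥ Y *ᵥ u))) ≤
      2 / (u ⬝ᵥ u) * (u ⬝ᵥ Y *ᵥ u) + 2 / (v ⬝ᵥ v) * (v ⬝ᵥ Y *ᵥ v) := by linarith
  have h3 := mul_le_mul_of_nonneg_left h2 (by positivity : 0 ≤ (u ⬝ᵥ u) * (v ⬝ᵥ v) / 2)
  have e1 : (u ⬝ᵥ u) * (v ⬝ᵥ v) / 2 *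
      (2 / (u ⬝ᵥ u) * (2 / (v ⬝ᵥ v) * ((u ⬝ᵥ v) * (v ⬝ᵥ Y *ᵥ u)))) =
      2 * (u ⬝ᵥ v) * (v ⬝ᵥ Y *ᵥ u) := by
    field_simp
  have e2 : (u ⬝ᵥ u) * (v ⬝ᵥ v) / 2 *
      (2 / (u ⬝ᵥ u) * (u ⬝ᵥ Y *ᵥ u) + 2 / (v ⬝ᵥ v) * (v ⬝ᵥ Y *ᵥ v)) =
      (v ⬝ᵥ v) * (u ⬝ᵥ Y *ᵥ u) + (u ⬝ᵥ u) * (v ⬝ᵥ Y *ᵥ v) := by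
    field_simp
  rwa [e1, e2] at h3

/-- Small rotations in the (a, b) plane, built from e_a and e_a + t e_b, change the trace at first
order by the antisymmetric part of Y and otherwise only at order t², so the antisymmetric part must
vanish. -/
theorem apply_le_apply_of_trace_le {Y : Matrix k k ℝ}
    (hY : ∀ U ∈ orthogonalGroup k ℝ, (U * Y).trace ≤ Y.trace)
    {a b : k} (hab : a ≠ b) : Y b a ≤ Y a b := by
  have key (t : ℝ) : t * (Y b a - Y a b) ≤ t ^ 2 * (Y a a + Y b b) := by
    have hu : (Pi.single a 1 : k → ℝ) ⬝ᵥ Pi.single a 1 = 1 := by simp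
    have huv : (Pi.single a 1 : k → ℝ) ⬝ᵥ (Pi.single a 1 + Pi.single b t) = 1 := by
      simp [hab]
    have hv : (Pi.single a 1 + Pi.single b t : k → ℝ) ⬝ᵥ (Pi.single a 1 + Pi.single b t) =
        1 + t ^ 2 := by
      simp [hab, hab.symm, sq]
    have h := two_mul_dotProduct_mul_le_of_trace_le hY (u := Pi.single a 1)
      (v := Pi.single a 1 + Pi.single b t) (by rw [hu]; exact one_pos) (by rw [hv]; positivity)
    rw [hu, hv, huv] at h
    simp [add_dotProduct, mulVec_add, mulVec_single] at h
    linarith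
  by_contra! hlt
  have hD : 0 < Y b a - Y a b := sub_pos.2 hlt
  set D := Y b a - Y a b
  set E := Y a a + Y b b
  -- For this t one has tD = t²(|E| + 1), so cancelling t² leaves |E| + 1 ≤ E.
  have h := key (D / (|E| + 1))
  have hE : 0 < |E| + 1 := by positivity
  have h1 : D / (|E| + 1) * D = (D / (|E| + 1)) ^ 2 * (|E| + 1) := by field_simp
  have h2 : (0 : ℝ) < (D / (|E| + 1)) ^ 2 := by positivity
  rw [h1] at h
  have := le_of_mul_le_mul_left h h2
  linarith [le_abs_self E]

/-- If the identity maximizes `U ↦ tr (U Y)` over the orthogonal group, then `Y` is symmetric and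
positive semidefinite. -/
theorem posSemidef_of_trace_le {Y : Matrix k k ℝ}
    (hY : ∀ U ∈ orthogonalGroup k ℝ, (U * Y).trace ≤ Y.trace) :
    Y.PosSemidef := by
  refine PosSemidef.of_dotProduct_mulVec_nonneg ?_ fun v => ?_
  · ext a b
    rw [conjTranspose_apply, star_trivial]
    rcases eq_or_ne a b with rfl | hab
    · rfl
    · exact le_antisymm (apply_le_apply_of_trace_le hY hab)
        (apply_le_apply_of_trace_le hY hab.symm)
  · simpa using dotProduct_mulVec_nonneg_of_trace_le hY v

end Optimality

/-! ### Optimal orthogonal alignment -/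

section Alignment

theorem isCompact_orthogonalGroup (k : Type*) [Fintype k] [DecidableEq k] :
    IsCompact (orthogonalGroup k ℝ : Set (Matrix k k ℝ)) := by
  have hK : IsCompact (Set.univ.pi fun _ : k => Set.univ.pi fun _ : k => Set.Icc (-1 : ℝ) 1) :=
    isCompact_univ_pi fun _ => isCompact_univ_pi fun _ => isCompact_Icc
  refine IsCompact.of_isClosed_subset hK ?_ ?_
  · have : (orthogonalGroup k ℝ : Set (Matrix k k ℝ)) = {U | U * Uᵀ = 1} := by
      ext U
      exact mem_orthogonalGroup_iff k ℝ
    rw [this]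
    exact isClosed_eq (by fun_prop) continuous_const
  · intro U hU i _ j _
    have h := entry_norm_bound_of_unitary (𝕜 := ℝ) hU i j
    exact abs_le.1 h

variable {n d : ℕ}

theorem frobNorm_sub_sq {X Y : Matrix (Fin n × Fin d) (Fin d) ℝ} (hX : X ∈ orthBlocks n d)
    (hY : Y ∈ orthBlocks n d) : frobNorm (X - Y) ^ 2 = 2 * (n * d) - 2 * (Xᵀ * Y).trace := by
  rw [frobNorm_sq, transpose_sub, Matrix.sub_mul, Matrix.mul_sub, Matrix.mul_sub,
    transpose_mul_self_of_mem_orthBlocks hX, transpose_mul_self_of_mem_orthBlocks hY]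
  simp only [trace_sub, trace_smul, trace_one, trace_transpose_mul_comm Y X, Fintype.card_fin,
    smul_eq_mul]
  ring

theorem orthDist_le (X Y : Matrix (Fin n × Fin d) (Fin d) ℝ) {g : Matrix (Fin d) (Fin d) ℝ}
    (hg : g ∈ orthogonalGroup (Fin d) ℝ) : orthDist X Y ≤ frobNorm (X - Y * g) :=
  ciInf_le (f := fun g : orthogonalGroup (Fin d) ℝ =>
    frobNorm (X - Y * (g : Matrix (Fin d) (Fin d) ℝ)))
    ⟨0, by rintro _ ⟨g, rfl⟩; exact frobNorm_nonneg _⟩ ⟨g, hg⟩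

/-- An optimal alignment of `Y` with `X` exists, and it makes `Xᵀ Y` positive semidefinite. -/
theorem exists_orthDist_eq {X Y : Matrix (Fin n × Fin d) (Fin d) ℝ} (hX : X ∈ orthBlocks n d)
    (hY : Y ∈ orthBlocks n d) :
    ∃ g ∈ orthogonalGroup (Fin d) ℝ,
      orthDist X Y = frobNorm (X - Y * g) ∧ (Xᵀ * (Y * g)).PosSemidef := by
  obtain ⟨g, hg, hmax⟩ := (isCompact_orthogonalGroup (Fin d)).exists_isMaxOn ⟨1, one_mem _⟩
    (f := fun g => (Xᵀ * (Y * g)).trace) (by fun_prop)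
  refine ⟨g, hg, le_antisymm (orthDist_le X Y hg) ?_, posSemidef_of_trace_le fun U hU => ?_⟩
  · refine le_ciInf fun U => ?_
    rw [← sq_le_sq₀ (frobNorm_nonneg _) (frobNorm_nonneg _),
      frobNorm_sub_sq hX (mul_mem_orthBlocks hY hg), frobNorm_sub_sq hX (mul_mem_orthBlocks hY U.2)]
    have := hmax U.2
    simp only [Set.mem_ofPred_eq] at this
    linarith
  -- Comparing g with gU and cycling the trace shows that the identity maximizes U ↦ tr(U XᵀYg).
  · have := hmax (mul_mem hg hU)
    simp only [Set.mem_ofPred_eq] at this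
    rw [trace_mul_comm]
    simpa only [Matrix.mul_assoc] using this

end Alignment

/-! ### Splitting the measurements into signal, weight deviation and noise -/

section Noise

variable {n d : ℕ}

theorem frobNorm_eq_of_block {X Y : Matrix (Fin n × Fin d) (Fin d) ℝ}
    (h : ∀ i, frobNorm (block X i) = frobNorm (block Y i)) : frobNorm X = frobNorm Y := by
  rw [← sq_eq_sq₀ (frobNorm_nonneg _) (frobNorm_nonneg _), frobNorm_sq_eq_sum_block,
    frobNorm_sq_eq_sum_block]
  simp only [h]

/-- The matrix whose `i`-th row lists the entries of the `i`-th block of `X`. -/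
def flatten (X : Matrix (Fin n × Fin d) (Fin d) ℝ) : Matrix (Fin n) (Fin d × Fin d) ℝ :=
  Matrix.of fun i p => X (i, p.1) p.2

theorem frobNorm_flatten (X : Matrix (Fin n × Fin d) (Fin d) ℝ) :
    frobNorm (flatten X) = frobNorm X := by
  rw [← sq_eq_sq₀ (frobNorm_nonneg _) (frobNorm_nonneg _), frobNorm_sq_eq_sum,
    frobNorm_sq_eq_sum]
  simp only [Fintype.sum_prod_type, flatten, of_apply]

/-- The deviation of the weighted noiseless measurements from uniform weights `μ`. -/
def weightDeviation (μ : ℝ) (W : Matrix (Fin n) (Fin n) ℝ)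
    (X : Matrix (Fin n × Fin d) (Fin d) ℝ) : Matrix (Fin n × Fin d) (Fin n × Fin d) ℝ :=
  (weightMat d W - constMat (Fin n × Fin d) μ) ⊙ (X * Xᵀ)

theorem weightDeviation_apply (μ : ℝ) (W : Matrix (Fin n) (Fin n) ℝ)
    (X : Matrix (Fin n × Fin d) (Fin d) ℝ) (p q : Fin n × Fin d) :
    weightDeviation μ W X p q = (W - constMat (Fin n) μ) p.1 q.1 * ∑ e, X p e * X q e := by
  simp [weightDeviation, weightMat, constMat, mul_apply, kroneckerMap_apply]

/-- The deviation is K ⊗ I_d, with K = W - μ11ᵀ, conjugated by the orthogonal block diagonal matrix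
Diag(X_i). Flattening blocks into rows turns K ⊗ I_d into left multiplication by K. -/
theorem frobNorm_weightDeviation_mul_le (μ : ℝ) (W : Matrix (Fin n) (Fin n) ℝ)
    {X : Matrix (Fin n × Fin d) (Fin d) ℝ} (hX : X ∈ orthBlocks n d)
    (Y : Matrix (Fin n × Fin d) (Fin d) ℝ) :
    frobNorm (weightDeviation μ W X * Y) ≤ opNorm (W - constMat (Fin n) μ) * frobNorm Y := by
  set K := W - constMat (Fin n) μ with hK
  let Z : Matrix (Fin n × Fin d) (Fin d) ℝ :=
    Matrix.of fun p c => ((block X p.1)ᵀ * block Y p.1) p.2 c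
  let U : Matrix (Fin n × Fin d) (Fin d) ℝ :=
    Matrix.of fun p c => ∑ j, K p.1 j * Z (j, p.2) c
  have hZ : frobNorm Z = frobNorm Y := frobNorm_eq_of_block fun i =>
    frobNorm_mul_of_transpose_mul (g := (block X i)ᵀ) (block Y i)
      (by rw [transpose_transpose]; exact block_mul_block_transpose hX i)
  have hU : flatten U = K * flatten Z := by
    ext i p
    simp [flatten, U, mul_apply]
  have hXU : frobNorm (weightDeviation μ W X * Y) = frobNorm U := by
    refine frobNorm_eq_of_block fun i => ?_
    have : block (weightDeviation μ W X * Y) i = block X i * block U i := by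
      ext a c
      simp only [block, submatrix_apply, id, mul_apply, weightDeviation_apply, ← hK,
        Fintype.sum_prod_type, U, Z, of_apply, transpose_apply, Finset.mul_sum, Finset.sum_mul]
      rw [Finset.sum_comm' (t' := Finset.univ) (s' := fun _ => Finset.univ) (by simp)]
      conv_rhs => rw [Finset.sum_comm]
      conv_lhs => rw [Finset.sum_comm]
      refine Finset.sum_congr rfl fun j _ => ?_
      rw [Finset.sum_comm]
      refine Finset.sum_congr rfl fun e _ => Finset.sum_congr rfl fun b _ => ?_
      ring
    rw [this, frobNorm_mul_of_transpose_mul _ (block_transpose_mul_block hX i)]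
  rw [hXU, ← frobNorm_flatten, hU, ← hZ, ← frobNorm_flatten Z]
  exact frobNorm_mul_le _ _

theorem measMat_eq (μ : ℝ) (W : Matrix (Fin n) (Fin n) ℝ)
    (X : Matrix (Fin n × Fin d) (Fin d) ℝ) (Δ : Matrix (Fin n × Fin d) (Fin n × Fin d) ℝ) :
    measMat W X Δ = μ • (X * Xᵀ) + weightDeviation μ W X + weightMat d W ⊙ Δ := by
  ext p q
  simp only [measMat, weightDeviation, hadamard_apply, Matrix.add_apply, Matrix.sub_apply,
    Matrix.smul_apply, constMat, of_apply, smul_eq_mul]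
  ring

theorem weightMat_isSymm {W : Matrix (Fin n) (Fin n) ℝ} (hW : W.IsSymm) :
    (weightMat d W).IsSymm := by
  ext p q
  simp [weightMat, kroneckerMap_apply, hW.apply]

theorem weightDeviation_isSymm (μ : ℝ) {W : Matrix (Fin n) (Fin n) ℝ} (hW : W.IsSymm)
    (X : Matrix (Fin n × Fin d) (Fin d) ℝ) : (weightDeviation μ W X).IsSymm := by
  ext p q
  rw [transpose_apply, weightDeviation_apply, weightDeviation_apply]
  simp [constMat, hW.apply, mul_comm]

theorem hadamard_weightMat_isSymm {W : Matrix (Fin n) (Fin n) ℝ} (hW : W.IsSymm)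
    {Δ : Matrix (Fin n × Fin d) (Fin n × Fin d) ℝ} (hΔ : Δ.IsSymm) :
    (weightMat d W ⊙ Δ).IsSymm := by
  ext p q
  rw [transpose_apply, hadamard_apply, hadamard_apply, hΔ.apply, (weightMat_isSymm hW).apply]

theorem blockEntry_measMat_self {μ : ℝ} {W : Matrix (Fin n) (Fin n) ℝ}
    (hW : ∀ i, W i i = μ) {X : Matrix (Fin n × Fin d) (Fin d) ℝ} (hX : X ∈ orthBlocks n d)
    {Δ : Matrix (Fin n × Fin d) (Fin n × Fin d) ℝ} (hΔ : ∀ i, blockEntry Δ i i = 0)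
    (i : Fin n) : blockEntry (measMat W X Δ) i i = μ • 1 := by
  rw [← block_mul_block_transpose hX i]
  ext a b
  have h : Δ (i, a) (i, b) = 0 := congr_fun₂ (hΔ i) a b
  simp [blockEntry, measMat, weightMat, kroneckerMap_apply, hW, h, block, mul_apply]

end Noise

/-! ### Aligned pairs and closeness of the maximizer to the ground truth -/

section Aligned

variable {n d : ℕ} {X Y : Matrix (Fin n × Fin d) (Fin d) ℝ}

theorem transpose_sub_mul_sub_of_isSymm (hX : X ∈ orthBlocks n d) (hY : Y ∈ orthBlocks n d)
    (h : (Xᵀ * Y).IsSymm) : (X - Y)ᵀ * (X - Y) = (2 : ℝ) • ((n : ℝ) • 1 - Xᵀ * Y) := by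
  have h' : Yᵀ * X = Xᵀ * Y := by
    rw [← h.eq, transpose_mul, transpose_transpose]
  rw [transpose_sub, Matrix.sub_mul, Matrix.mul_sub, Matrix.mul_sub,
    transpose_mul_self_of_mem_orthBlocks hX, transpose_mul_self_of_mem_orthBlocks hY, h',
    two_smul]
  abel

/-- Symmetry of XᵀY makes Xᵀ(X - Y) equal to half of (X - Y)ᵀ(X - Y): the difference of aligned
points is nearly orthogonal to X, up to second order. -/
theorem frobNorm_transpose_mul_sub_le (hX : X ∈ orthBlocks n d) (hY : Y ∈ orthBlocks n d)
    (h : (Xᵀ * Y).IsSymm) : frobNorm (Xᵀ * (X - Y)) ≤ frobNorm (X - Y) ^ 2 / 2 := by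
  have h1 : Xᵀ * (X - Y) = (1 / 2 : ℝ) • ((X - Y)ᵀ * (X - Y)) := by
    rw [transpose_sub_mul_sub_of_isSymm hX hY h, smul_smul, Matrix.mul_sub,
      transpose_mul_self_of_mem_orthBlocks hX]
    norm_num
  rw [h1, frobNorm_smul]
  have := frobNorm_mul_le_mul (X - Y)ᵀ (X - Y)
  rw [frobNorm_transpose] at this
  rw [abs_of_pos (by norm_num)]
  linarith

theorem le_norm_transpose_mul_mulVec (hX : X ∈ orthBlocks n d) (hY : Y ∈ orthBlocks n d)
    (h : (Xᵀ * Y).IsSymm) (v : Fin d → ℝ) :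
    (n - frobNorm (X - Y) ^ 2 / 2) * ‖WithLp.toLp 2 v‖ ≤ ‖WithLp.toLp 2 ((Xᵀ * Y) *ᵥ v)‖ := by
  have h1 : (n : ℝ) • v = Xᵀ *ᵥ (X - Y) *ᵥ v + (Xᵀ * Y) *ᵥ v := by
    rw [mulVec_mulVec, ← add_mulVec, Matrix.mul_sub, sub_add_cancel,
      transpose_mul_self_of_mem_orthBlocks hX, smul_mulVec, one_mulVec]
  have h2 := norm_mulVec_le_frobNorm (Xᵀ * (X - Y)) v
  have h3 := norm_add_le (WithLp.toLp 2 (Xᵀ *ᵥ (X - Y) *ᵥ v)) (WithLp.toLp 2 ((Xᵀ * Y) *ᵥ v))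
  rw [← WithLp.toLp_add, ← h1, WithLp.toLp_smul, norm_smul, mulVec_mulVec, Real.norm_natCast] at h3
  have h4 := mul_le_mul_of_nonneg_right (frobNorm_transpose_mul_sub_le hX hY h)
    (norm_nonneg (WithLp.toLp 2 v))
  linarith

theorem frobNorm_of_mem_orthBlocks (hX : X ∈ orthBlocks n d) :
    frobNorm X = Real.sqrt n * Real.sqrt d := by
  rw [← Real.sqrt_mul (by positivity), eq_comm, Real.sqrt_eq_iff_mul_self_eq (by positivity)
    (frobNorm_nonneg _), ← sq, frobNorm_sq, transpose_mul_self_of_mem_orthBlocks hX]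
  simp

/-- A feasible point with larger objective value than the ground truth is close to it. -/
theorem mul_frobNorm_sub_le (hX : X ∈ orthBlocks n d) (hY : Y ∈ orthBlocks n d)
    (hXY : (Xᵀ * Y).PosSemidef) {μ ν : ℝ} (hμ : 0 < μ)
    {N : Matrix (Fin n × Fin d) (Fin n × Fin d) ℝ} (hN : N.IsSymm)
    (hν : ∀ Z : Matrix (Fin n × Fin d) (Fin d) ℝ, frobNorm (N * Z) ≤ ν * frobNorm Z)
    (hle : (Xᵀ * (μ • (X * Xᵀ) + N) * X).trace ≤ (Yᵀ * (μ • (X * Xᵀ) + N) * Y).trace) :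
    n * μ * frobNorm (X - Y) ≤ 4 * ν * (Real.sqrt n * Real.sqrt d) := by
  have hS : (Xᵀ * Y).IsSymm := by simpa [IsHermitian, IsSymm] using hXY.isHermitian
  have hVV := transpose_sub_mul_sub_of_isSymm hX hY hS
  have hXX := transpose_mul_self_of_mem_orthBlocks hX
  set V := X - Y with hV
  set P := Xᵀ * Y with hP
  have hYX : Yᵀ * X = P := by rw [← hS.eq, hP, transpose_mul, transpose_transpose]
  have e1 : (Xᵀ * (μ • (X * Xᵀ) + N) * X).trace = μ * (n ^ 2 * d) + (Xᵀ * (N * X)).trace := by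
    have : Xᵀ * (μ • (X * Xᵀ) + N) * X = μ • ((Xᵀ * X) * (Xᵀ * X)) + Xᵀ * (N * X) := by
      simp only [Matrix.mul_add, Matrix.add_mul, Matrix.mul_smul, Matrix.smul_mul,
        Matrix.mul_assoc]
    rw [this, hXX]
    simp only [Matrix.smul_mul, Matrix.mul_smul, Matrix.one_mul, trace_add, trace_smul, trace_one,
      Fintype.card_fin, smul_eq_mul]
    ring
  have e2 : (Yᵀ * (μ • (X * Xᵀ) + N) * Y).trace = μ * (P * P).trace + (Yᵀ * (N * Y)).trace := by
    have : Yᵀ * (μ • (X * Xᵀ) + N) * Y = μ • ((Yᵀ * X) * (Xᵀ * Y)) + Yᵀ * (N * Y) := by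
      simp only [Matrix.mul_add, Matrix.add_mul, Matrix.mul_smul, Matrix.smul_mul,
        Matrix.mul_assoc]
    rw [this, hYX, ← hP, trace_add, trace_smul, smul_eq_mul]
  -- A difference of squares for the symmetric form N, leaving a bound linear in ‖V‖ to set against
  -- the quadratic signal gap.
  have e3 : (Yᵀ * (N * Y)).trace - (Xᵀ * (N * X)).trace = -((X + Y)ᵀ * (N * V)).trace := by
    have hc : (Xᵀ * (N * Y)).trace = (Yᵀ * (N * X)).trace := by
      rw [trace_transpose_mul_comm, transpose_mul, hN.eq, Matrix.mul_assoc]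
    simp only [hV, transpose_add, Matrix.add_mul, Matrix.mul_sub, trace_add, trace_sub, hc]
    ring
  -- Since VᵀV = 2(nI - P) and P ⪰ 0, tr P² ≤ n tr P; and nd - tr P = ‖V‖²/2.
  have e4 : n * (frobNorm V ^ 2 / 2) ≤ n ^ 2 * d - (P * P).trace := by
    have t1 : frobNorm V ^ 2 = 2 * (n * d - P.trace) := by
      rw [frobNorm_sq, hVV]
      simp
    have t2 : 0 ≤ (P * (Vᵀ * V)).trace := by
      have := (hXY.mul_mul_conjTranspose_same V).trace_nonneg
      rwa [conjTranspose_eq_transpose_of_trivial, Matrix.mul_assoc, trace_mul_comm,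
        Matrix.mul_assoc] at this
    rw [hVV] at t2
    simp only [Matrix.mul_smul, Matrix.mul_sub, Matrix.mul_one, trace_smul, trace_sub,
      smul_eq_mul] at t2
    nlinarith
  have e5 : -((X + Y)ᵀ * (N * V)).trace ≤
      2 * (Real.sqrt n * Real.sqrt d) * (ν * frobNorm V) := by
    have a1 := neg_mul_le_trace_transpose_mul (X + Y) (N * V)
    have a2 := frobNorm_add_le X Y
    rw [frobNorm_of_mem_orthBlocks hX, frobNorm_of_mem_orthBlocks hY] at a2
    have a3 := mul_le_mul a2 (hν V) (frobNorm_nonneg _) (by positivity)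
    linarith
  have e6 : μ * (n * (frobNorm V ^ 2 / 2)) ≤ μ * (n ^ 2 * d - (P * P).trace) :=
    mul_le_mul_of_nonneg_left e4 hμ.le
  have e7 : frobNorm V * (n * μ * frobNorm V) ≤
      frobNorm V * (4 * ν * (Real.sqrt n * Real.sqrt d)) := by
    rw [e1, e2] at hle
    nlinarith
  -- If V = 0 nothing can be cancelled; the bound on N applied to X shows that the right side is
  -- nonnegative.
  rcases (frobNorm_nonneg V).eq_or_lt with h0 | h0
  · have h1 := hν X
    rw [frobNorm_of_mem_orthBlocks hX] at h1
    have := (frobNorm_nonneg _).trans h1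
    rw [← h0]
    nlinarith
  · exact le_of_mul_le_mul_left e7 h0

end Aligned

/-! ### Blockwise optimality and spectral lower bounds -/

section Stationarity

variable {n d : ℕ}

/-- The block column whose only nonzero block is `B`, in position `i`. -/
def singleBlock (i : Fin n) (B : Matrix (Fin d) (Fin d) ℝ) : Matrix (Fin n × Fin d) (Fin d) ℝ :=
  Matrix.of fun p c => if p.1 = i then B p.2 c else 0

theorem block_singleBlock (i j : Fin n) (B : Matrix (Fin d) (Fin d) ℝ) :
    block (singleBlock i B) j = if j = i then B else 0 := by
  ext a c
  by_cases h : j = i <;> simp [block, singleBlock, h]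

theorem block_add (X Y : Matrix (Fin n × Fin d) (Fin d) ℝ) (i : Fin n) :
    block (X + Y) i = block X i + block Y i := rfl

theorem block_sub (X Y : Matrix (Fin n × Fin d) (Fin d) ℝ) (i : Fin n) :
    block (X - Y) i = block X i - block Y i := rfl

theorem block_smul (c : ℝ) (X : Matrix (Fin n × Fin d) (Fin d) ℝ) (i : Fin n) :
    block (c • X) i = c • block X i := rfl

theorem block_mul (X : Matrix (Fin n × Fin d) (Fin d) ℝ) (g : Matrix (Fin d) (Fin d) ℝ)
    (i : Fin n) : block (X * g) i = block X i * g := rfl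

theorem block_mul_singleBlock (C : Matrix (Fin n × Fin d) (Fin n × Fin d) ℝ) (i j : Fin n)
    (B : Matrix (Fin d) (Fin d) ℝ) :
    block (C * singleBlock i B) j = blockEntry C j i * B := by
  ext a c
  simp [block, singleBlock, blockEntry, mul_apply, Fintype.sum_prod_type]

theorem block_blockDiag_mul (B : Fin n → Matrix (Fin d) (Fin d) ℝ)
    (X : Matrix (Fin n × Fin d) (Fin d) ℝ) (i : Fin n) :
    block (blockDiag B * X) i = B i * block X i := by
  ext a c
  simp [block, blockDiag, mul_apply, Fintype.sum_prod_type]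

/-- First-order optimality in a single block. -/
theorem IsGlobalMaximizer.posSemidef_block {C : Matrix (Fin n × Fin d) (Fin n × Fin d) ℝ}
    {X : Matrix (Fin n × Fin d) (Fin d) ℝ} (hX : IsGlobalMaximizer C X) (hC : C.IsSymm)
    {μ : ℝ} (hμ : 0 ≤ μ) (i : Fin n) (hCi : blockEntry C i i = μ • 1) :
    (block (C * X) i * (block X i)ᵀ).PosSemidef := by
  refine posSemidef_of_trace_le fun U hU => ?_
  -- Adding B in block i replaces X_i by UᵀX_i, which stays feasible.
  set B : Matrix (Fin d) (Fin d) ℝ := (Uᵀ - 1) * block X i with hB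
  set F := singleBlock i B with hF
  have hmem : X + F ∈ orthBlocks n d := by
    intro j
    rw [block_add, hF, block_singleBlock]
    split_ifs with h
    · subst h
      rw [hB, Matrix.sub_mul, Matrix.one_mul, add_sub_cancel]
      exact mul_mem (Unitary.star_mem hU) (hX.1 j)
    · simpa using hX.1 j
  have h := hX.2 _ hmem
  have e : ((X + F)ᵀ * C * (X + F)).trace =
      (Xᵀ * C * X).trace + 2 * (Fᵀ * (C * X)).trace + (Fᵀ * (C * F)).trace := by
    have hc : (Xᵀ * (C * F)).trace = (Fᵀ * (C * X)).trace := by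
      rw [trace_transpose_mul_comm, transpose_mul, hC.eq, Matrix.mul_assoc]
    simp only [transpose_add, Matrix.add_mul, Matrix.mul_add, trace_add, Matrix.mul_assoc, hc]
    ring
  have hF1 (Z : Matrix (Fin n × Fin d) (Fin d) ℝ) :
      (Fᵀ * Z).trace = (Bᵀ * block Z i).trace := by
    rw [trace_transpose_mul_eq_sum_block, Finset.sum_eq_single i]
    · rw [hF, block_singleBlock, if_pos rfl]
    · intro j _ hj
      rw [hF, block_singleBlock, if_neg hj]
      simp
    · simp
  -- The diagonal block μI makes the quadratic term nonnegative, so maximality forces the linear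
  -- term to be nonpositive for every U.
  have h1 : 0 ≤ (Fᵀ * (C * F)).trace := by
    rw [hF1, hF, block_mul_singleBlock, hCi, Matrix.smul_mul, Matrix.one_mul, Matrix.mul_smul,
      trace_smul, ← frobNorm_sq]
    exact mul_nonneg hμ (sq_nonneg _)
  have h2 : (Fᵀ * (C * X)).trace = (U * (block (C * X) i * (block X i)ᵀ)).trace -
      (block (C * X) i * (block X i)ᵀ).trace := by
    rw [hF1, hB, transpose_mul, transpose_sub, transpose_transpose, transpose_one,
      Matrix.mul_assoc, trace_mul_comm, Matrix.mul_assoc, Matrix.sub_mul, Matrix.one_mul,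
      trace_sub]
  rw [e, h2] at h
  linarith

/-- On a unit eigenvector, ‖Sx‖ is the eigenvalue itself because S is positive semidefinite, so the
norm bound is an eigenvalue bound. -/
theorem posSemidef_sub_smul_one {k : Type*} [Fintype k] [DecidableEq k] {S : Matrix k k ℝ}
    (hS : S.PosSemidef) {s : ℝ}
    (hs : ∀ x, s * ‖WithLp.toLp 2 x‖ ≤ ‖WithLp.toLp 2 (S *ᵥ x)‖) :
    (S - s • 1).PosSemidef := by
  have hH : (S - s • 1 : Matrix k k ℝ).IsHermitian := by
    refine hS.isHermitian.sub ?_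
    simp [IsHermitian, conjTranspose_eq_transpose_of_trivial]
  rw [hH.posSemidef_iff_eigenvalues_nonneg]
  intro j
  set c := hH.eigenvalues j with hc
  set x : EuclideanSpace ℝ k := hH.eigenvectorBasis j with hx
  have hx1 : ‖x‖ = 1 := hH.eigenvectorBasis.orthonormal.1 j
  have h1 : (S - s • 1) *ᵥ x.ofLp = c • x.ofLp := hH.mulVec_eigenvectorBasis j
  have h2 : S *ᵥ x.ofLp = (c + s) • x.ofLp := by
    rw [sub_mulVec, smul_mulVec, one_mulVec] at h1
    rw [add_smul, ← h1, sub_add_cancel]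
  have h3 : 0 ≤ c + s := by
    have := hS.dotProduct_mulVec_nonneg x.ofLp
    rw [h2, star_trivial, dotProduct_smul, ← norm_toLp_sq, WithLp.toLp_ofLp, hx1] at this
    simpa using this
  have h4 := hs x.ofLp
  rw [h2, WithLp.toLp_smul, norm_smul, WithLp.toLp_ofLp, hx1, Real.norm_of_nonneg h3] at h4
  simpa using h4

/-- For orthogonal X and Y both diagonal terms equal tr S, so the trace is half the quadratic form
of S at Y - X. -/
theorem trace_transpose_sub_mul_mul_ge {k : Type*} [Fintype k] [DecidableEq k]
    {S X Y : Matrix k k ℝ} {s : ℝ} (hS : (S - s • 1).PosSemidef) (hX : X * Xᵀ = 1)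
    (hY : Y * Yᵀ = 1) :
    s / 2 * frobNorm (Y - X) ^ 2 ≤ ((Y - X)ᵀ * (S * Y)).trace := by
  have hSs : Sᵀ = S := by
    have := hS.isHermitian
    rw [IsHermitian, conjTranspose_eq_transpose_of_trivial, transpose_sub, transpose_smul,
      transpose_one] at this
    exact sub_left_injective this
  have hXX : (Xᵀ * (S * X)).trace = S.trace := by
    rw [trace_mul_comm, Matrix.mul_assoc, hX, Matrix.mul_one]
  have hYY : (Yᵀ * (S * Y)).trace = S.trace := by
    rw [trace_mul_comm, Matrix.mul_assoc, hY, Matrix.mul_one]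
  have hXY : (Yᵀ * (S * X)).trace = (Xᵀ * (S * Y)).trace := by
    rw [trace_transpose_mul_comm, transpose_mul, hSs, Matrix.mul_assoc]
  have h1 : ((Y - X)ᵀ * (S * (Y - X))).trace = 2 * ((Y - X)ᵀ * (S * Y)).trace := by
    simp only [transpose_sub, Matrix.sub_mul, Matrix.mul_sub, trace_sub, hXX, hYY, hXY]
    ring
  have h2 := (hS.conjTranspose_mul_mul_same (Y - X)).trace_nonneg
  rw [conjTranspose_eq_transpose_of_trivial, Matrix.mul_assoc, Matrix.sub_mul, Matrix.mul_sub,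
    trace_sub, Matrix.smul_mul, Matrix.one_mul, Matrix.mul_smul, trace_smul, ← frobNorm_sq,
    smul_eq_mul, h1] at h2
  linarith

end Stationarity

/-! ### Lower bound for the residual -/

section ErrorBound

variable {n d : ℕ}

theorem leftAbs_posSemidef (X : Matrix (Fin d) (Fin d) ℝ) : (leftAbs X).PosSemidef := by
  open scoped MatrixOrder in
  exact nonneg_iff_posSemidef.1 (CFC.sqrt_nonneg _)

/-- The signal term μX_iXᵀY dominates. Blockwise control is available for M at the maximizer Y but
for E only at the ground truth X, so EY is split as EX - E(X - Y), the last piece being bounded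
through the full Frobenius norm. -/
theorem le_norm_block_mulVec {X Y : Matrix (Fin n × Fin d) (Fin d) ℝ} (hX : X ∈ orthBlocks n d)
    (hY : Y ∈ orthBlocks n d) (hXY : (Xᵀ * Y).IsSymm) {μ ν c : ℝ} (hμ : 0 ≤ μ)
    {M E : Matrix (Fin n × Fin d) (Fin n × Fin d) ℝ}
    (hM : ∀ i y, ‖WithLp.toLp 2 (block (M * Y) i *ᵥ y)‖ ≤ c * ‖WithLp.toLp 2 y‖)
    (hE : ∀ i y, ‖WithLp.toLp 2 (block (E * X) i *ᵥ y)‖ ≤ c * ‖WithLp.toLp 2 y‖)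
    (hν : ∀ Z : Matrix (Fin n × Fin d) (Fin d) ℝ, frobNorm (E * Z) ≤ ν * frobNorm Z)
    (i : Fin n) (y : Fin d → ℝ) :
    (μ * (n - frobNorm (X - Y) ^ 2 / 2) - 2 * c - ν * frobNorm (X - Y)) * ‖WithLp.toLp 2 y‖ ≤
      ‖WithLp.toLp 2 (block ((μ • (X * Xᵀ) + M + E) * Y) i *ᵥ y)‖ := by
  have hb (Z : Matrix (Fin n × Fin d) (Fin d) ℝ) : frobNorm (block Z i) ≤ frobNorm Z := by
    rw [← sq_le_sq₀ (frobNorm_nonneg _) (frobNorm_nonneg _), frobNorm_sq_eq_sum_block Z]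
    exact Finset.single_le_sum (f := fun i => frobNorm (block Z i) ^ 2)
      (fun _ _ => sq_nonneg _) (Finset.mem_univ i)
  have h1 : μ • (block X i *ᵥ (Xᵀ * Y) *ᵥ y) = block ((μ • (X * Xᵀ) + M + E) * Y) i *ᵥ y -
      block (M * Y) i *ᵥ y - block (E * X) i *ᵥ y + block (E * (X - Y)) i *ᵥ y := by
    have : block ((μ • (X * Xᵀ) + M + E) * Y) i = μ • (block X i * (Xᵀ * Y)) +
        block (M * Y) i + block (E * X) i - block (E * (X - Y)) i := by
      rw [Matrix.mul_sub, Matrix.add_mul, Matrix.add_mul, Matrix.smul_mul, Matrix.mul_assoc X,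
        block_add, block_add, block_smul, block_sub, block_mul]
      abel
    rw [this, mulVec_mulVec]
    simp only [sub_mulVec, add_mulVec, smul_mulVec]
    abel
  have h2 : ‖WithLp.toLp 2 (μ • (block X i *ᵥ (Xᵀ * Y) *ᵥ y))‖ =
      μ * ‖WithLp.toLp 2 ((Xᵀ * Y) *ᵥ y)‖ := by
    rw [WithLp.toLp_smul, norm_smul, Real.norm_of_nonneg hμ,
      norm_toLp_mulVec_of_transpose_mul (block_transpose_mul_block hX i)]
  rw [h1, WithLp.toLp_add, WithLp.toLp_sub, WithLp.toLp_sub] at h2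
  have h3 := norm_add_le
    (WithLp.toLp 2 (block ((μ • (X * Xᵀ) + M + E) * Y) i *ᵥ y) -
      WithLp.toLp 2 (block (M * Y) i *ᵥ y) - WithLp.toLp 2 (block (E * X) i *ᵥ y))
    (WithLp.toLp 2 (block (E * (X - Y)) i *ᵥ y))
  have h4 := norm_sub_le
    (WithLp.toLp 2 (block ((μ • (X * Xᵀ) + M + E) * Y) i *ᵥ y) -
      WithLp.toLp 2 (block (M * Y) i *ᵥ y)) (WithLp.toLp 2 (block (E * X) i *ᵥ y))
  have h5 := norm_sub_le (WithLp.toLp 2 (block ((μ • (X * Xᵀ) + M + E) * Y) i *ᵥ y))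
      (WithLp.toLp 2 (block (M * Y) i *ᵥ y))
  have h6 := norm_mulVec_le_frobNorm (block (E * (X - Y)) i) y
  have h7 := mul_le_mul_of_nonneg_right ((hb _).trans (hν (X - Y)))
    (norm_nonneg (WithLp.toLp 2 y))
  have h8 := mul_le_mul_of_nonneg_left (le_norm_transpose_mul_mulVec hX hY hXY y) hμ
  linarith [hM i y, hE i y]

/-- A lower bound of the residual by the distance to an aligned stationary point. -/
theorem le_mul_residual {X Y G : Matrix (Fin n × Fin d) (Fin d) ℝ}
    (hY : Y ∈ orthBlocks n d) (hG : G ∈ orthBlocks n d) {α μ ν s r : ℝ}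
    {C N : Matrix (Fin n × Fin d) (Fin n × Fin d) ℝ} (hμ : 0 ≤ μ)
    (hC : C = μ • (X * Xᵀ) + N)
    (hS : ∀ i, (block (C * Y) i * (block Y i)ᵀ - s • 1).PosSemidef)
    (hν : ∀ Z : Matrix (Fin n × Fin d) (Fin d) ℝ, frobNorm (N * Z) ≤ ν * frobNorm Z)
    (hr : frobNorm (Xᵀ * (G - Y)) ≤ r * frobNorm (G - Y)) :
    (s / 2 - μ * r ^ 2 - ν - α / 2) * frobNorm (G - Y) ^ 2 ≤
      frobNorm (G - Y) * residual α C G := by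
  set V := G - Y with hV
  have e1 : residualMat α C G * G =
      blockDiag (fun i => leftAbs ((blockCol (shifted α C) i)ᵀ * G)) * G -
        C * V - C * Y - α • G := by
    rw [residualMat, Matrix.sub_mul, shifted, Matrix.add_mul, Matrix.smul_mul, Matrix.one_mul,
      hV, Matrix.mul_sub]
    abel
  have e2 : 0 ≤ (Vᵀ * (blockDiag
      (fun i => leftAbs ((blockCol (shifted α C) i)ᵀ * G)) * G)).trace := by
    rw [trace_transpose_mul_eq_sum_block]
    refine Finset.sum_nonneg fun i _ => ?_
    rw [block_blockDiag_mul, hV, block_sub]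
    have := trace_transpose_sub_mul_mul_ge (s := 0)
      (S := leftAbs ((blockCol (shifted α C) i)ᵀ * G))
      (by simpa using leftAbs_posSemidef _) (block_mul_block_transpose hY i)
      (block_mul_block_transpose hG i)
    simpa using this
  -- Blockwise (CY)_i = S_i Y_i with S_i ⪰ s I, since Y_i is orthogonal.
  have e3 : (Vᵀ * (C * Y)).trace ≤ -(s / 2 * frobNorm V ^ 2) := by
    rw [trace_transpose_mul_eq_sum_block, frobNorm_sq_eq_sum_block, Finset.mul_sum,
      ← Finset.sum_neg_distrib]
    refine Finset.sum_le_sum fun i _ => ?_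
    have := trace_transpose_sub_mul_mul_ge (hS i) (block_mul_block_transpose hG i)
      (block_mul_block_transpose hY i)
    rw [Matrix.mul_assoc (block (C * Y) i), block_transpose_mul_block hY, Matrix.mul_one,
      ← neg_sub (block G i), ← block_sub, ← hV, frobNorm_neg, transpose_neg, Matrix.neg_mul,
      trace_neg] at this
    linarith
  have e4 : (Vᵀ * (C * V)).trace ≤ (μ * r ^ 2 + ν) * frobNorm V ^ 2 := by
    have h1 : (Vᵀ * (C * V)).trace = μ * frobNorm (Xᵀ * V) ^ 2 + (Vᵀ * (N * V)).trace := by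
      rw [hC, frobNorm_sq, transpose_mul, transpose_transpose]
      simp only [Matrix.add_mul, Matrix.mul_add, Matrix.smul_mul, Matrix.mul_smul, trace_add,
        trace_smul, smul_eq_mul, Matrix.mul_assoc]
    have h2 := (trace_transpose_mul_le V (N * V)).trans
      (mul_le_mul_of_nonneg_left (hν V) (frobNorm_nonneg V))
    have h3 := mul_le_mul_of_nonneg_left (pow_le_pow_left₀ (frobNorm_nonneg _) hr 2) hμ
    rw [h1]
    linarith
  have e5 : (Vᵀ * G).trace = frobNorm V ^ 2 / 2 := by
    rw [hV, frobNorm_sub_sq hG hY, transpose_sub, Matrix.sub_mul, trace_sub,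
      trace_transpose_mul_comm Y, transpose_mul_self_of_mem_orthBlocks hG]
    simp
    ring
  have e6 := trace_transpose_mul_le V (residualMat α C G * G)
  have e7 : (Vᵀ * (residualMat α C G * G)).trace =
      (Vᵀ * (blockDiag (fun i => leftAbs ((blockCol (shifted α C) i)ᵀ * G)) * G)).trace -
        (Vᵀ * (C * V)).trace - (Vᵀ * (C * Y)).trace - α * (Vᵀ * G).trace := by
    rw [e1]
    simp only [Matrix.mul_sub, Matrix.mul_smul, trace_sub, trace_smul, smul_eq_mul]
  rw [residual]
  rw [e7, e5] at e6
  linarith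

end ErrorBound

/-! ### Orthogonal invariance and numerical constants -/

variable {n d : ℕ}

theorem opNorm_block_le_blockSupNorm (X : Matrix (Fin n × Fin d) (Fin d) ℝ) (i : Fin n) :
    opNorm (block X i) ≤ blockSupNorm X :=
  le_ciSup (f := fun i => opNorm (block X i)) (Set.finite_range _).bddAbove i

theorem norm_block_mul_mulVec_le (X : Matrix (Fin n × Fin d) (Fin d) ℝ)
    {g : Matrix (Fin d) (Fin d) ℝ} (hg : g ∈ orthogonalGroup (Fin d) ℝ) {c : ℝ} (i : Fin n)
    (hc : opNorm (block X i) ≤ c) (y : Fin d → ℝ) :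
    ‖WithLp.toLp 2 (block (X * g) i *ᵥ y)‖ ≤ c * ‖WithLp.toLp 2 y‖ := by
  rw [block_mul, ← mulVec_mulVec,
    ← norm_toLp_mulVec_of_transpose_mul ((mem_orthogonalGroup_iff' (Fin d) ℝ).1 hg) y]
  exact (norm_mulVec_le_opNorm _ _).trans (mul_le_mul_of_nonneg_right hc (norm_nonneg _))

theorem IsGlobalMaximizer.mul {C : Matrix (Fin n × Fin d) (Fin n × Fin d) ℝ}
    {X : Matrix (Fin n × Fin d) (Fin d) ℝ} (hX : IsGlobalMaximizer C X)
    {g : Matrix (Fin d) (Fin d) ℝ} (hg : g ∈ orthogonalGroup (Fin d) ℝ) :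
    IsGlobalMaximizer C (X * g) := by
  refine ⟨mul_mem_orthBlocks hX.1 hg, fun G hG => (hX.2 G hG).trans_eq ?_⟩
  have hg' : g * gᵀ = 1 := (mem_orthogonalGroup_iff (Fin d) ℝ).1 hg
  have h : (X * g)ᵀ * C * (X * g) = gᵀ * (Xᵀ * C * X * g) := by
    simp only [transpose_mul, Matrix.mul_assoc]
  rw [h, trace_mul_comm gᵀ, Matrix.mul_assoc _ g gᵀ, hg', Matrix.mul_one]

theorem mul_mul_transpose_of_mem {k : Type*} (X : Matrix k (Fin d) ℝ)
    {g : Matrix (Fin d) (Fin d) ℝ} (hg : g ∈ orthogonalGroup (Fin d) ℝ) :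
    X * g * (X * g)ᵀ = X * Xᵀ := by
  have hg' : g * gᵀ = 1 := (mem_orthogonalGroup_iff (Fin d) ℝ).1 hg
  rw [transpose_mul, Matrix.mul_assoc, ← Matrix.mul_assoc g, hg', Matrix.one_mul]

theorem orthDist_le_orthDist_add {G X Y : Matrix (Fin n × Fin d) (Fin d) ℝ}
    (hG : G ∈ orthBlocks n d) (hX : X ∈ orthBlocks n d) :
    orthDist G Y ≤ orthDist G X + frobNorm (X - Y) := by
  obtain ⟨k, hk, hdist, -⟩ := exists_orthDist_eq hG hX
  refine (orthDist_le G Y hk).trans ?_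
  have h1 : G - Y * k = (G - X * k) + (X - Y) * k := by
    rw [Matrix.sub_mul]
    abel
  rw [h1, hdist, ← frobNorm_mul_of_mul_transpose (X - Y)
    ((mem_orthogonalGroup_iff (Fin d) ℝ).1 hk)]
  exact frobNorm_add_le _ _

theorem orthDist_mul_right (G X : Matrix (Fin n × Fin d) (Fin d) ℝ)
    {g : Matrix (Fin d) (Fin d) ℝ} (hg : g ∈ orthogonalGroup (Fin d) ℝ) :
    orthDist G (X * g) = orthDist G X := by
  refine Function.Surjective.iInf_congr
    (fun u : orthogonalGroup (Fin d) ℝ => (⟨g, hg⟩ * u : orthogonalGroup (Fin d) ℝ))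
    (Group.mulLeft_bijective (⟨g, hg⟩ : orthogonalGroup (Fin d) ℝ)).surjective fun u => ?_
  change frobNorm (G - X * (g * (u : Matrix (Fin d) (Fin d) ℝ))) = _
  rw [Matrix.mul_assoc]

/-- The numerical part of the local error bound, with `q = n ^ (1 / 4)`. -/
theorem local_error_constants {q μ ν δ ε α s r b e w : ℝ} (hq : 1 ≤ q) (hμ : 0 < μ)
    (hν : ν ≤ q ^ 3 * μ / 40) (he : e ≤ ν) (hw : w ≤ q ^ 3 * μ / 40) (hδ0 : 0 ≤ δ)
    (hδ : q ^ 4 * μ * δ ≤ 4 * w * q ^ 2) (hε : ε ≤ q ^ 2 / 5 + δ)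
    (hα : α ≤ q ^ 4 * μ / 20) (hr : r = ε / 2 + δ) (hr0 : 0 ≤ r)
    (hs : s = μ * (q ^ 4 - δ ^ 2 / 2) - 2 * (q ^ 4 * μ / 10) - e * δ)
    (hb : b = s / 2 - μ * r ^ 2 - ν - α / 2) : q ^ 4 * μ / 10 ≤ b := by
  have q0 : 0 < q := by linarith
  -- The bound on w turns 4wq² into at most q⁵μ/10.
  have hδq : δ ≤ q / 10 := by
    have h1 : q ^ 4 * μ * δ ≤ q ^ 4 * μ * (q / 10) := by nlinarith [pow_pos q0 2]
    exact le_of_mul_le_mul_left h1 (by positivity)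
  have hqq : q ≤ q ^ 2 := by nlinarith
  have h34 : q ^ 3 ≤ q ^ 4 := pow_le_pow_right₀ hq (by norm_num)
  have h24 : q ^ 2 ≤ q ^ 4 := pow_le_pow_right₀ hq (by norm_num)
  have hrq : r ≤ q ^ 2 / 4 := by rw [hr]; linarith
  have h1 : μ * r ^ 2 ≤ μ * (q ^ 4 / 16) := by
    refine mul_le_mul_of_nonneg_left ?_ hμ.le
    calc r ^ 2 ≤ (q ^ 2 / 4) ^ 2 := pow_le_pow_left₀ hr0 hrq 2
      _ = q ^ 4 / 16 := by ring
  have h2 : μ * (δ ^ 2 / 2) ≤ μ * (q ^ 4 / 200) := by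
    refine mul_le_mul_of_nonneg_left ?_ hμ.le
    have := pow_le_pow_left₀ hδ0 hδq 2
    nlinarith
  have h3 : e * δ ≤ q ^ 4 * μ / 400 := by
    calc e * δ ≤ (q ^ 3 * μ / 40) * δ := mul_le_mul_of_nonneg_right (he.trans hν) hδ0
      _ ≤ (q ^ 3 * μ / 40) * (q / 10) := mul_le_mul_of_nonneg_left hδq (by positivity)
      _ = q ^ 4 * μ / 400 := by ring
  have h4 : q ^ 3 * μ ≤ q ^ 4 * μ := mul_le_mul_of_nonneg_right h34 hμ.le
  have h5 : 0 < q ^ 4 * μ := by positivity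
  -- In units of q⁴μ: s ≥ 1 - 1/200 - 1/5 - 1/400, and the losses are at most 1/16, 1/40 and 1/40,
  -- leaving about 0.28.
  rw [hb, hs]
  linarith

end OrthSync

/-! ### Assembly of the local error bound -/

open OrthSync Matrix in
theorem theorem4p3 (n d : ℕ) (hn : 1 ≤ n) (hd : 1 ≤ d) (μ α : ℝ) (hμ : 0 < μ) (hα : 0 ≤ α)
    (W : Matrix (Fin n) (Fin n) ℝ) (hW : W.IsSymm) (hWdiag : ∀ i, W i i = μ)
    (Gstar : Matrix (Fin n × Fin d) (Fin d) ℝ) (hGstar : Gstar ∈ OrthSync.orthBlocks n d)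
    (Δ : Matrix (Fin n × Fin d) (Fin n × Fin d) ℝ) (hΔ : Δ.IsSymm)
    (hΔdiag : ∀ i, OrthSync.blockEntry Δ i i = 0)
    (h_noise : OrthSync.opNorm (W - OrthSync.constMat (Fin n) μ)
        + OrthSync.opNorm (OrthSync.weightMat d W ⊙ Δ)
      ≤ (n : ℝ) ^ (3 / 4 : ℝ) * μ / (40 * Real.sqrt d))
    (h_block : OrthSync.blockSupNorm ((OrthSync.weightMat d W ⊙ Δ) * Gstar) ≤ n * μ / 10)
    (h_step : α ≤ n * μ / (20 * Real.sqrt 2))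
    (Ghat : Matrix (Fin n × Fin d) (Fin d) ℝ)
    (hGhat : OrthSync.IsGlobalMaximizer (OrthSync.measMat W Gstar Δ) Ghat)
    (h_graph : (⨆ i : Fin n, OrthSync.opNorm
        ((OrthSync.blockCol
          ((OrthSync.weightMat d W - OrthSync.constMat (Fin n × Fin d) μ) ⊙ (Gstar * Gstarᵀ)) i)ᵀ
          * Ghat)) ≤ n * μ / 10)
    (G : Matrix (Fin n × Fin d) (Fin d) ℝ) (hG : G ∈ OrthSync.orthBlocks n d)
    (hdist : OrthSync.orthDist G Gstar ≤ Real.sqrt n / 5) :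
    n * μ / 10 * OrthSync.orthDist G Ghat
      ≤ OrthSync.residual α (OrthSync.measMat W Gstar Δ) G := by
  obtain ⟨g, hg, hε, hGY⟩ := exists_orthDist_eq hG hGhat.1
  have hmax := hGhat.mul hg
  set Y := Ghat * g with hYdef
  have hY := hmax.1
  -- The ground truth is aligned with Y rather than with G, because the objective comparison needs
  -- XᵀY positive semidefinite; its distance to G is recovered by the triangle inequality.
  obtain ⟨h, hh, -, hYX⟩ := exists_orthDist_eq hY hGstar
  have hX := mul_mem_orthBlocks hGstar hh
  set X := Gstar * h with hXdef
  have hXX : X * Xᵀ = Gstar * Gstarᵀ := mul_mul_transpose_of_mem Gstar hh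
  set M := weightDeviation μ W Gstar with hM
  set E := weightMat d W ⊙ Δ with hE
  have hMs : M.IsSymm := weightDeviation_isSymm μ hW Gstar
  have hEs : E.IsSymm := hadamard_weightMat_isSymm hW hΔ
  have hC : measMat W Gstar Δ = μ • (X * Xᵀ) + (M + E) := by
    rw [hXX, ← add_assoc]
    exact measMat_eq μ W Gstar Δ
  have hCs : (measMat W Gstar Δ).IsSymm := by
    rw [hC]
    refine IsSymm.add (IsSymm.smul ?_ μ) (hMs.add hEs)
    rw [IsSymm, transpose_mul, transpose_transpose]
  set ν := opNorm (W - constMat (Fin n) μ) + opNorm E with hν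
  have hNle (Z : Matrix (Fin n × Fin d) (Fin d) ℝ) :
      frobNorm ((M + E) * Z) ≤ ν * frobNorm Z := by
    rw [Matrix.add_mul, hν, add_mul]
    exact (frobNorm_add_le _ _).trans (add_le_add
      (frobNorm_weightDeviation_mul_le μ W hGstar Z) (frobNorm_mul_le E Z))
  have hXY : (Xᵀ * Y).PosSemidef := by
    simpa [conjTranspose_eq_transpose_of_trivial, transpose_mul] using hYX.conjTranspose
  have hXYs : (Xᵀ * Y).IsSymm := by simpa [IsHermitian, IsSymm] using hXY.isHermitian
  have hGYs : (Gᵀ * Y).IsSymm := by simpa [IsHermitian, IsSymm] using hGY.isHermitian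
  have hδ := mul_frobNorm_sub_le hX hY hXY hμ (hMs.add hEs) hNle
    (by rw [← hC]; exact hmax.2 X hX)
  set δ := frobNorm (X - Y) with hδdef
  have hε_le : frobNorm (G - Y) ≤ Real.sqrt n / 5 + δ := by
    rw [← hε, ← orthDist_mul_right G Ghat hg]
    refine (orthDist_le_orthDist_add hG hX).trans (add_le_add_left ?_ _)
    rwa [hXdef, orthDist_mul_right G Gstar hh]
  rw [hε]
  set ε := frobNorm (G - Y) with hεdef
  have hMY (i : Fin n) (y : Fin d → ℝ) :
      ‖WithLp.toLp 2 (block (M * Y) i *ᵥ y)‖ ≤ n * μ / 10 * ‖WithLp.toLp 2 y‖ := by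
    rw [hYdef, ← Matrix.mul_assoc]
    refine norm_block_mul_mulVec_le _ hg i ?_ y
    refine le_trans ?_ h_graph
    have : block (M * Ghat) i = (blockCol M i)ᵀ * Ghat := by
      rw [show (blockCol M i)ᵀ = Mᵀ.submatrix (fun b => (i, b)) id from rfl, hMs.eq]
      rfl
    rw [this]
    exact le_ciSup (f := fun i => opNorm ((blockCol M i)ᵀ * Ghat))
      (Set.finite_range _).bddAbove i
  have hEX (i : Fin n) (y : Fin d → ℝ) :
      ‖WithLp.toLp 2 (block (E * X) i *ᵥ y)‖ ≤ n * μ / 10 * ‖WithLp.toLp 2 y‖ := by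
    rw [hXdef, ← Matrix.mul_assoc]
    exact norm_block_mul_mulVec_le _ hh i ((opNorm_block_le_blockSupNorm _ i).trans h_block) y
  set s := μ * (n - δ ^ 2 / 2) - 2 * (n * μ / 10) - opNorm E * δ with hs
  have hS (i : Fin n) : (block (measMat W Gstar Δ * Y) i * (block Y i)ᵀ - s • 1).PosSemidef := by
    refine posSemidef_sub_smul_one (hmax.posSemidef_block hCs hμ.le i
      (blockEntry_measMat_self hWdiag hGstar hΔdiag i)) fun x => ?_
    have hx := le_norm_block_mulVec hX hY hXYs hμ.le hMY hEX (frobNorm_mul_le E) i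
      ((block Y i)ᵀ *ᵥ x)
    rwa [norm_toLp_mulVec_of_transpose_mul
      (by rw [transpose_transpose]; exact block_mul_block_transpose hY i), mulVec_mulVec,
      add_assoc, ← hC] at hx
  have hε0 : 0 ≤ ε := frobNorm_nonneg _
  have hδ0 : 0 ≤ δ := frobNorm_nonneg _
  -- Alignment of G with Y makes Yᵀ(G - Y) second order, giving ε/2; passing from Y to X costs δ.
  have hr : frobNorm (Xᵀ * (G - Y)) ≤ (ε / 2 + δ) * frobNorm (G - Y) := by
    have h1 : Xᵀ * (G - Y) = Yᵀ * (G - Y) + (X - Y)ᵀ * (G - Y) := by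
      rw [← Matrix.add_mul, transpose_sub, add_sub_cancel]
    have h2 := frobNorm_transpose_mul_sub_le hY hG
      (by simpa only [transpose_mul, transpose_transpose] using hGYs.transpose)
    have h3 : frobNorm (Yᵀ * (G - Y)) = frobNorm (Yᵀ * (Y - G)) := by
      rw [← frobNorm_neg, ← Matrix.mul_neg, neg_sub]
    have h4 := frobNorm_mul_le_mul (X - Y)ᵀ (G - Y)
    rw [frobNorm_transpose] at h4
    rw [frobNorm_sub_rev Y G] at h2
    rw [h1]
    refine (frobNorm_add_le _ _).trans ?_
    rw [h3]
    linarith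
  have key := le_mul_residual (α := α) hY hG hμ.le hC hS hNle hr
  have hn1 : (1 : ℝ) ≤ n := by exact_mod_cast hn
  have hd1 : 1 ≤ Real.sqrt d := Real.one_le_sqrt.2 (by exact_mod_cast hd)
  set q : ℝ := (n : ℝ) ^ (1 / 4 : ℝ) with hq
  have hq1 : 1 ≤ q := Real.one_le_rpow hn1 (by norm_num)
  have hqpow (k : ℕ) : q ^ k = (n : ℝ) ^ (1 / 4 * k : ℝ) := by
    rw [Real.rpow_mul (by positivity), Real.rpow_natCast]
  have hq4 : q ^ 4 = n := by rw [hqpow]; norm_num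
  have hq3 : q ^ 3 = (n : ℝ) ^ (3 / 4 : ℝ) := by rw [hqpow]; norm_num
  have hq2 : q ^ 2 = Real.sqrt n := by rw [hqpow, Real.sqrt_eq_rpow]; norm_num
  -- The √d in the noise hypothesis absorbs the one in the bound for δ; the bare bound on ν follows
  -- from √d ≥ 1.
  have hw : ν * Real.sqrt d ≤ q ^ 3 * μ / 40 := by
    rw [hq3]
    have := mul_le_mul_of_nonneg_right h_noise (zero_le_one.trans hd1)
    refine this.trans_eq ?_
    field_simp
  have hE0 : 0 ≤ opNorm E := opNorm_nonneg E
  have hK0 : 0 ≤ opNorm (W - constMat (Fin n) μ) := opNorm_nonneg _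
  have hν0 : 0 ≤ ν := add_nonneg hK0 hE0
  have hconst : q ^ 4 * μ / 10 ≤ s / 2 - μ * (ε / 2 + δ) ^ 2 - ν - α / 2 := by
    refine local_error_constants (ν := ν) (δ := δ) (ε := ε) (α := α) (e := opNorm E)
      (w := ν * Real.sqrt d) hq1 hμ
      ((le_mul_of_one_le_right hν0 hd1).trans hw) (by rw [hν]; linarith) hw hδ0 ?_ ?_ ?_ rfl
      (by positivity) ?_ rfl
    · rw [hq4, hq2]
      linarith
    · rw [hq2]
      exact hε_le
    · rw [hq4]
      refine h_step.trans ?_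
      refine div_le_div_of_nonneg_left (by positivity) (by norm_num) ?_
      have : 1 ≤ Real.sqrt 2 := Real.one_le_sqrt.2 (by norm_num)
      linarith
    · rw [hq4]
  rw [hq4] at hconst
  rcases hε0.eq_or_lt with h0 | h0
  · rw [← h0, mul_zero]
    exact frobNorm_nonneg _
  · have h1 := mul_le_mul_of_nonneg_right hconst (sq_nonneg ε)
    have h2 : ε * (n * μ / 10 * ε) ≤ ε * residual α (measMat W Gstar Δ) G := by linarith
    exact le_of_mul_le_mul_left h2 h0
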